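/- **Presentations.** For an alphabet $X$ and a set of relations $R\subseteq X^*\times X^*$, a monoid $N$ has presentation $\langle X\mid R\rangle$ via a morphism $\phi:X^*\to N$ if $\phi$ is surjective and its kernel is the congruence on $X^*$ generated by $R$. We write $\iota$ for the empty word. **Wreath products.** Let $M$ be a monoid with identity $1$, let $M_0=M\cup\{0\}$ be $M$ with a new zero adjoined, and let $\mathcal I_n$ be the symmetric inverse monoid of all partial bijections of $\{1,\dots,n\}$, composed from left to right. The wreath product is $$M\wr\mathcal I_n=\{(\mathbf a,\alpha)\in M_0^n\times\mathcal I_n : \operatorname{supp}(\mathbf a)=\operatorname{dom}(\alpha)\},\qquad (\mathbf a,\alpha)(\mathbf b,\beta)=(\mathbf a\cdot{}^{\alpha}\mathbf b,\ \alpha\beta),$$ where $\operatorname{supp}(\mathbf a)=\{i : a_i\neq0\}$, and the $i$th entry of ${}^\alpha\mathbf b$ is $b_{i\alpha}$ if $i\in\operatorname{dom}(\alpha)$ and $0$ otherwise. We identify $\mathbf a\in M_0^n$ with $(\mathbf a,\mathrm{id}_{\operatorname{supp}(\mathbf a)})\in M\wr\mathcal I_n$, and $\alpha\in\mathcal I_n$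 with $(\mathbf 1_{\operatorname{dom}(\alpha)},\alpha)\in M\wr\mathcal I_n$, where $\mathbf 1_{A}$ is the tuple with entries $1$ at the positions in $A$ and $0$ elsewhere. **Theorem.** Let $M$ be a monoid with presentation $\langle X_M\mid R_M\rangle$ via $\phi_M:X_M^*\to M$, and let $n\ge1$. Then $M\wr\mathcal I_n$ has presentation $\langle X'\mid R'\rangle$ via $\phi'$, where * $X'=\{s_1,\dots,s_{n-1},e\}\cup X_M$ (a disjoint union); * $\phi':(X')^*\to M\wr\mathcal I_n$ is the morphism that maps $s_i$ to the transposition $(i,i+1)$, $e$ to the identity map of $\{2,\dots,n\}$, and $x\in X_M$ to the tuple $(\phi_M(x),1,\dots,1)$; * $R'$ consists of the relations in $R_M$ together with the following relations, in which $x,y$ range over $X_M$, the subscripts $i,j$ range over $\{1,\dots,n-1\}$ subject to the stated constraints, and the relations that involve $s_1$ are present only if $n\ge2$: - $s_i^2=\iota$; - $s_is_j=s_js_i$ if $|i-j|>1$; - $s_is_js_i=s_js_is_j$ if $|i-j|=1$; - $e^2=e$; - $es_1es_1=es_1e=s_1es_1e$; - $es_i=s_ie$ if $i\ge2$; - $s_ix=xs_i$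 if $i\ge2$; - $xs_1ys_1=s_1ys_1x$; - $es_1xs_1=s_1xs_1e$; - $ex=xe=e$. -/

import Mathlib

/-- `HasPresentationVia R φ`: the monoid `N` has presentation `⟨X | R⟩` via `φ : X* → N`, i.e. `φ` is
a surjective monoid morphism whose kernel is the congruence on `X*` generated by `R`. -/
def HasPresentationVia {X N : Type*} [Monoid N] (R : FreeMonoid X → FreeMonoid X → Prop)
    (φ : FreeMonoid X →* N) : Prop :=
  Function.Surjective φ ∧ Con.ker φ = conGen R

/-- The symmetric inverse monoid `I_n`: all partial bijections of an `n`-element set. The points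
`1, …, n` are represented by `0, …, n - 1`. -/
abbrev SymInv (n : ℕ) : Type := Fin n ≃. Fin n

/-- Partial bijections are composed from left to right. -/
instance SymInv.instMonoid (n : ℕ) : Monoid (SymInv n) where
  mul α β := α.trans β
  one := PEquiv.refl (Fin n)
  mul_assoc := PEquiv.trans_assoc
  one_mul := PEquiv.refl_trans
  mul_one := PEquiv.trans_refl

/-- The domain of a partial bijection. -/
def SymInv.dom {n : ℕ} (α : SymInv n) : Set (Fin n) := {i | (α i).isSome}

/-- For `α ∈ I_n` and a tuple `a` over `M ∪ {0}`, the tuple whose `i`th entry is `a_{iα}` if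
`i ∈ dom α`, and `0` otherwise. -/
def SymInv.act {M : Type*} {n : ℕ} (α : SymInv n) (a : Fin n → WithZero M) : Fin n → WithZero M :=
  fun i => (α i).elim 0 a

/-- The wreath product `M ≀ I_n`: pairs `(a, α)` with `a` an `n`-tuple over the monoid `M ∪ {0}`
(a new zero is adjoined to `M`) and `α ∈ I_n`, such that `supp a = dom α`. -/
@[ext]
structure WreathSymInv (M : Type*) (n : ℕ) where
  /-- the tuple `a` -/
  tuple : Fin n → WithZero M
  /-- the partial bijection `α` -/
  map : SymInv n
  supp_eq_dom : Function.support tuple = map.dom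

namespace WreathSymInv

variable {M : Type*} [Monoid M] {n : ℕ}

/-- `(a, α)(b, β) = (a · ᵅb, αβ)`. -/
instance : Mul (WreathSymInv M n) where
  mul p q :=
    { tuple := p.tuple * p.map.act q.tuple
      map := p.map * q.map
      supp_eq_dom := by
        ext i
        have hp := Set.ext_iff.mp p.supp_eq_dom i
        have hq := fun j => Set.ext_iff.mp q.supp_eq_dom j
        simp only [Function.mem_support, SymInv.dom, Set.mem_ofPred_eq] at hp hq
        change p.tuple i * (p.map i).elim 0 q.tuple ≠ 0 ↔ ((p.map i).bind q.map).isSome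
        cases h : p.map i with
        | none => simp
        | some j =>
          rw [h] at hp
          simpa [hp] using hq j }

instance : One (WreathSymInv M n) where
  one :=
    { tuple := 1
      map := 1
      supp_eq_dom := by
        ext i
        simp only [Function.mem_support, SymInv.dom, Set.mem_ofPred_eq]
        change (1 : WithZero M) ≠ 0 ↔ (some i).isSome
        simp }

theorem mul_tuple (p q : WreathSymInv M n) : (p * q).tuple = p.tuple * p.map.act q.tuple := rfl

theorem mul_map (p q : WreathSymInv M n) : (p * q).map = p.map * q.map := rfl

theorem one_tuple : (1 : WreathSymInv M n).tuple = 1 := rfl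

theorem one_map : (1 : WreathSymInv M n).map = 1 := rfl

instance : Monoid (WreathSymInv M n) where
  mul_assoc p q r := by
    refine WreathSymInv.ext ?_ (mul_assoc p.map q.map r.map)
    funext i
    change p.tuple i * (p.map i).elim 0 q.tuple * ((p.map i).bind q.map).elim 0 r.tuple =
      p.tuple i * (p.map i).elim 0 (fun j => q.tuple j * (q.map j).elim 0 r.tuple)
    cases p.map i with
    | none => simp
    | some j => simp [mul_assoc]
  one_mul p := by
    refine WreathSymInv.ext ?_ (one_mul p.map)
    funext i
    change 1 * p.tuple i = p.tuple i
    simp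
  mul_one p := by
    refine WreathSymInv.ext ?_ (mul_one p.map)
    funext i
    have hp := Set.ext_iff.mp p.supp_eq_dom i
    simp only [Function.mem_support, SymInv.dom, Set.mem_ofPred_eq] at hp
    change p.tuple i * (p.map i).elim 0 (fun _ => 1) = p.tuple i
    cases h : p.map i with
    | none =>
      rw [h] at hp
      have h0 : p.tuple i = 0 := by simpa using hp
      simp [h0]
    | some j => simp

open Classical in
/-- The copy in `M ≀ I_n` of a tuple `a` over `M ∪ {0}`: the pair `(a, id_{supp a})`. -/
noncomputable def ofTuple (a : Fin n → WithZero M) : WreathSymInv M n where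
  tuple := a
  map := PEquiv.ofSet (Function.support a)
  supp_eq_dom := by
    ext i
    by_cases h : a i = 0 <;> simp [SymInv.dom, PEquiv.ofSet, h]

/-- The copy in `M ≀ I_n` of `α ∈ I_n`: the pair `(1_{dom α}, α)`, whose tuple has entries `1` on
`dom α` and `0` elsewhere. -/
def ofSymInv (α : SymInv n) : WreathSymInv M n where
  tuple := fun i => if (α i).isSome then 1 else 0
  map := α
  supp_eq_dom := by
    ext i
    cases h : α i <;> simp [SymInv.dom, h]

end WreathSymInv

/-- Popova's alphabet `{s_1, …, s_{n-1}, e}`. The letter `s_k` of the usual numbering is `s i` with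
`i = k - 1`, that is, `s_1, …, s_{n-1}` are `s 0, …, s (n - 2)`. -/
inductive PopovaGen (n : ℕ) : Type
  | s (i : Fin (n - 1))
  | e

namespace PopovaGen

/-- The image in `I_n` of a letter: `s i` goes to the transposition of the consecutive points
`i, i + 1`, and `e` goes to the identity map of the set of all points but the first. -/
def toSymInv {n : ℕ} : PopovaGen n → SymInv n
  | s i => (Equiv.swap (⟨i.val, by omega⟩ : Fin n) ⟨i.val + 1, by omega⟩).toPEquiv
  | e => PEquiv.ofSet {k : Fin n | k.val ≠ 0}

end PopovaGen

open FreeMonoid in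
/-- Popova's relations for `I_n`. A condition `i.val = 0` says that the letter is `s_1`, and a
condition `1 ≤ i.val` says that it is one of `s_2, s_3, …`. -/
inductive PopovaRel (n : ℕ) : FreeMonoid (PopovaGen n) → FreeMonoid (PopovaGen n) → Prop
  | s_sq (i : Fin (n - 1)) :
      PopovaRel n (of (.s i) * of (.s i)) 1
  | s_comm (i j : Fin (n - 1)) (h : 1 < |(i.val : ℤ) - (j.val : ℤ)|) :
      PopovaRel n (of (.s i) * of (.s j)) (of (.s j) * of (.s i))
  | braid (i j : Fin (n - 1)) (h : |(i.val : ℤ) - (j.val : ℤ)| = 1) :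
      PopovaRel n (of (.s i) * of (.s j) * of (.s i)) (of (.s j) * of (.s i) * of (.s j))
  | e_sq :
      PopovaRel n (of .e * of .e) (of .e)
  | eses_ese (i : Fin (n - 1)) (h : i.val = 0) :
      PopovaRel n (of .e * of (.s i) * of .e * of (.s i)) (of .e * of (.s i) * of .e)
  | ese_sese (i : Fin (n - 1)) (h : i.val = 0) :
      PopovaRel n (of .e * of (.s i) * of .e) (of (.s i) * of .e * of (.s i) * of .e)
  | es_comm (i : Fin (n - 1)) (h : 1 ≤ i.val) :
      PopovaRel n (of .e * of (.s i)) (of (.s i) * of .e)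

/-- The alphabet `{s_1, …, s_{n-1}, e} ∪ X`, a disjoint union. -/
abbrev WreathGen (n : ℕ) (X : Type*) : Type _ := PopovaGen n ⊕ X

namespace WreathGen

variable {n : ℕ} {X : Type*}

/-- The letter `s_{i+1}`, as a word. -/
def s (i : Fin (n - 1)) : FreeMonoid (WreathGen n X) := FreeMonoid.of (Sum.inl (PopovaGen.s i))

/-- The letter `e`, as a word. -/
def e : FreeMonoid (WreathGen n X) := FreeMonoid.of (Sum.inl PopovaGen.e)

/-- A letter `x ∈ X`, as a word. -/
def gen (x : X) : FreeMonoid (WreathGen n X) := FreeMonoid.of (Sum.inr x)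

end WreathGen

open WreathGen in
/-- The relations of the presentation of `M ≀ I_n`: Popova's relations, the relations `R` for `M`,
and the relations that link the letters of the two alphabets. -/
inductive WreathRel (n : ℕ) {X : Type*} (R : FreeMonoid X → FreeMonoid X → Prop) :
    FreeMonoid (WreathGen n X) → FreeMonoid (WreathGen n X) → Prop
  | popova (u v : FreeMonoid (PopovaGen n)) (h : PopovaRel n u v) :
      WreathRel n R (FreeMonoid.map Sum.inl u) (FreeMonoid.map Sum.inl v)
  | base (u v : FreeMonoid X) (h : R u v) :
      WreathRel n R (FreeMonoid.map Sum.inr u) (FreeMonoid.map Sum.inr v)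
  | sx_comm (i : Fin (n - 1)) (h : 1 ≤ i.val) (x : X) :
      WreathRel n R (s i * gen x) (gen x * s i)
  | xsys_comm (i : Fin (n - 1)) (h : i.val = 0) (x y : X) :
      WreathRel n R (gen x * s i * gen y * s i) (s i * gen y * s i * gen x)
  | esxs_comm (i : Fin (n - 1)) (h : i.val = 0) (x : X) :
      WreathRel n R (e * s i * gen x * s i) (s i * gen x * s i * e)
  | ex_xe (x : X) :
      WreathRel n R (e * gen x) (gen x * e)
  | xe_e (x : X) :
      WreathRel n R (gen x * e) e

/-- The morphism from words over `{s_1, …, s_{n-1}, e} ∪ X` to `M ≀ I_n` that maps `s_i` and `e` to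
the copies of their images in `I_n`, and `x ∈ X` to the copy of the tuple `(φ(x), 1, …, 1)`. -/
noncomputable def wreathHom (n : ℕ) {M X : Type*} [Monoid M] (φ : FreeMonoid X →* M) :
    FreeMonoid (WreathGen n X) →* WreathSymInv M n :=
  FreeMonoid.lift (Sum.elim
    (fun g => WreathSymInv.ofSymInv g.toSymInv)
    (fun x => WreathSymInv.ofTuple
      (fun i => if i.val = 0 then ((φ (FreeMonoid.of x) : M) : WithZero M) else 1)))

/-- A family in a monoid satisfying the Coxeter relations of the symmetric group. -/
structure IsBraidInvolutive {Q : Type*} [Monoid Q] {k : ℕ} (t : Fin k → Q) : Prop where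
  sq (i : Fin k) : t i * t i = 1
  comm (i j : Fin k) (h : i.val + 1 < j.val) : t i * t j = t j * t i
  braid (i j : Fin k) (h : i.val + 1 = j.val) : t i * t j * t i = t j * t i * t j

namespace IsBraidInvolutive

variable {Q : Type*} [Monoid Q] {k : ℕ}

theorem comp_succ {t : Fin (k + 1) → Q} (h : IsBraidInvolutive t) :
    IsBraidInvolutive fun i : Fin k => t i.succ where
  sq i := h.sq _
  comm i j hij := h.comm _ _ (by simpa using hij)
  braid i j hij := h.braid _ _ (by simpa using hij)

theorem prodMk {Q' : Type*} [Monoid Q'] {t : Fin k → Q} {t' : Fin k → Q'}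
    (h : IsBraidInvolutive t) (h' : IsBraidInvolutive t') :
    IsBraidInvolutive fun i => (t i, t' i) where
  sq i := Prod.ext (h.sq i) (h'.sq i)
  comm i j hij := Prod.ext (h.comm i j hij) (h'.comm i j hij)
  braid i j hij := Prod.ext (h.braid i j hij) (h'.braid i j hij)

theorem swap (k : ℕ) :
    IsBraidInvolutive fun i : Fin k => Equiv.swap i.castSucc i.succ where
  sq i := Equiv.swap_mul_self _ _
  comm i j h := by
    refine (Equiv.Perm.disjoint_swap_swap ?_).commute.eq
    simp [Fin.ext_iff]; omega
  braid i j h := by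
    have hj : j.castSucc = i.succ := Fin.ext (by simp [h])
    have h1 : i.castSucc ≠ i.succ := by simp [Fin.ext_iff]
    have h2 : i.castSucc ≠ j.succ := by simp [Fin.ext_iff]; omega
    have h3 : i.succ ≠ j.succ := by simp [Fin.ext_iff]; omega
    rw [hj, Equiv.swap_mul_swap_mul_swap h1 h2, Equiv.swap_comm i.castSucc,
      Equiv.swap_comm i.succ j.succ, Equiv.swap_mul_swap_mul_swap h3.symm h2.symm,
      Equiv.swap_comm]

end IsBraidInvolutive

/-- The product `t (p - 1) * ⋯ * t 1 * t 0`. -/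
def descendingProd {Q : Type*} [Monoid Q] {k : ℕ} (t : Fin k → Q) (p : Fin (k + 1)) : Q :=
  Fin.induction 1 (fun i c => t i * c) p

section

variable {Q : Type*} [Monoid Q] {k : ℕ}

@[simp]
theorem descendingProd_zero (t : Fin k → Q) : descendingProd t 0 = 1 := rfl

theorem descendingProd_succ (t : Fin k → Q) (i : Fin k) :
    descendingProd t i.succ = t i * descendingProd t i.castSucc := by
  simp [descendingProd]

theorem IsBraidInvolutive.mul_descendingProd_of_lt {t : Fin k → Q} (h : IsBraidInvolutive t)
    (p : Fin (k + 1)) (i : Fin k) (hp : p < i.castSucc) :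
    t i * descendingProd t p = descendingProd t p * t i := by
  induction p using Fin.induction with
  | zero => simp
  | succ j ih =>
    have hj : j.val + 1 < i.val := hp
    have ih := ih (Fin.lt_def.mpr (by simp; omega))
    rw [descendingProd_succ, ← mul_assoc, ← h.comm j i hj, mul_assoc, ih, mul_assoc]

theorem IsBraidInvolutive.mul_descendingProd_of_gt {t : Fin (k + 1) → Q}
    (h : IsBraidInvolutive t) (p : Fin (k + 2)) (i : Fin k) (hp : i.val + 1 < p.val) :
    t i.castSucc * descendingProd t p = descendingProd t p * t i.succ := by
  induction p using Fin.induction with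
  | zero => simp at hp
  | succ j ih =>
    have hj : i.val < j.val := by simpa using hp
    rw [descendingProd_succ]
    rcases (Nat.succ_le_of_lt hj).eq_or_lt with hij | hij
    · have hj' : j = i.succ := Fin.ext (by simpa using hij.symm)
      have hc : j.castSucc = i.castSucc.succ := by rw [hj']; rfl
      have hb := h.braid i.castSucc i.succ (by simp)
      have hl := h.mul_descendingProd_of_lt i.castSucc.castSucc i.succ (Fin.lt_def.mpr (by simp))
      rw [hc, hj', descendingProd_succ]
      simp only [← mul_assoc]
      rw [hb, mul_assoc, hl, ← mul_assoc]
    · rw [← mul_assoc, h.comm i.castSucc j (by simpa using hij), mul_assoc,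
        ih (by simpa using hij), mul_assoc]

/-- Multiplying a descending product by a generator on the left. -/
theorem IsBraidInvolutive.exists_mul_descendingProd {t : Fin (k + 1) → Q}
    (h : IsBraidInvolutive t) (i : Fin (k + 1)) (p : Fin (k + 2)) :
    (∃ p', t i * descendingProd t p = descendingProd t p') ∨
      ∃ j : Fin k, t i * descendingProd t p = descendingProd t p * t j.succ := by
  rcases lt_trichotomy p i.castSucc with hp | hp | hp
  · right
    have hi : i ≠ 0 := by rintro rfl; simp at hp
    obtain ⟨j, rfl⟩ := Fin.exists_succ_eq.mpr hi
    exact ⟨j, h.mul_descendingProd_of_lt p _ hp⟩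
  · exact .inl ⟨i.succ, by rw [descendingProd_succ, hp]⟩
  · have hp' : i.val < p.val := hp
    rcases (Nat.succ_le_of_lt hp').eq_or_lt with hip | hip
    · have : p = i.succ := Fin.ext (by simpa using hip.symm)
      exact .inl ⟨i.castSucc, by rw [this, descendingProd_succ, ← mul_assoc, h.sq, one_mul]⟩
    · right
      have hi : i.val < k := by omega
      exact ⟨⟨i.val, hi⟩, h.mul_descendingProd_of_gt p ⟨i.val, hi⟩ hip⟩

end

namespace Equiv.Perm

/-- The embedding of `Perm (Fin n)` in `Perm (Fin (n + 1))` as the stabiliser of `0`. -/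
def consHom (n : ℕ) : Perm (Fin n) →* Perm (Fin (n + 1)) where
  toFun g := decomposeFin.symm (0, g)
  map_one' := by simp; rfl
  map_mul' g h := by
    ext x
    refine Fin.cases ?_ (fun i => ?_) x <;> simp

@[simp]
theorem consHom_zero {n : ℕ} (g : Perm (Fin n)) : consHom n g 0 = 0 := by simp [consHom]

@[simp]
theorem consHom_succ {n : ℕ} (g : Perm (Fin n)) (i : Fin n) :
    consHom n g i.succ = (g i).succ := by simp [consHom]

theorem consHom_injective (n : ℕ) : Function.Injective (consHom n) := fun g h e => by
  simpa [consHom] using e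

theorem exists_consHom_eq {n : ℕ} (g : Perm (Fin (n + 1))) (h : g 0 = 0) :
    ∃ g', consHom n g' = g := by
  obtain ⟨⟨p, g'⟩, rfl⟩ := decomposeFin.symm.surjective g
  rw [decomposeFin_symm_apply_zero] at h
  exact ⟨g', by rw [h]; rfl⟩

theorem consHom_swap {n : ℕ} (i j : Fin n) :
    consHom n (swap i j) = swap i.succ j.succ := by
  ext x
  refine Fin.cases ?_ (fun l => ?_) x
  · rw [consHom_zero, swap_apply_of_ne_of_ne (Fin.succ_ne_zero _).symm (Fin.succ_ne_zero _).symm]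
  · rw [consHom_succ, (Fin.succ_injective n).map_swap]

end Equiv.Perm

theorem descendingProd_swap_apply_zero {k : ℕ} (p : Fin (k + 1)) :
    descendingProd (fun i : Fin k => Equiv.swap i.castSucc i.succ) p 0 = p := by
  induction p using Fin.induction with
  | zero => simp
  | succ i ih => rw [descendingProd_succ, Equiv.Perm.mul_apply, ih, Equiv.swap_apply_left]

theorem snd_descendingProd {Q Q' : Type*} [Monoid Q] [Monoid Q'] {k : ℕ} (t : Fin k → Q)
    (t' : Fin k → Q') (p : Fin (k + 1)) :
    (descendingProd (fun i => (t i, t' i)) p).2 = descendingProd t' p := by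
  induction p using Fin.induction with
  | zero => simp
  | succ i ih => rw [descendingProd_succ, descendingProd_succ, Prod.snd_mul, ih]

/-- A submonoid of `Q × G` that projects bijectively to `G` is the graph of a morphism. -/
theorem Submonoid.exists_hom_of_graph {Q G : Type*} [Monoid Q] [Monoid G] (S : Submonoid (Q × G))
    (hs : ∀ g, ∃ q, (q, g) ∈ S) (hi : ∀ x ∈ S, ∀ y ∈ S, x.2 = y.2 → x = y) :
    ∃ f : G →* Q, ∀ x ∈ S, f x.2 = x.1 := by
  choose f hf using hs
  refine ⟨⟨⟨f, ?_⟩, fun g h => ?_⟩, fun x hx => ?_⟩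
  · exact congrArg Prod.fst (hi _ (hf 1) _ S.one_mem rfl)
  · exact congrArg Prod.fst (hi _ (hf (g * h)) _ (S.mul_mem (hf g) (hf h)) rfl)
  · exact congrArg Prod.fst (hi _ (hf x.2) _ hx rfl)

/-- The Coxeter relations define the symmetric group. -/
theorem IsBraidInvolutive.exists_perm_hom {Q : Type*} [Monoid Q] :
    ∀ {k : ℕ} {t : Fin k → Q}, IsBraidInvolutive t →
      ∃ f : Equiv.Perm (Fin (k + 1)) →* Q, ∀ i, f (Equiv.swap i.castSucc i.succ) = t i
  | 0, _, _ => ⟨1, fun i => i.elim0⟩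
  | k + 1, t, ht => by
    obtain ⟨f, hf⟩ := ht.comp_succ.exists_perm_hom
    set T : Fin (k + 1) → Q × Equiv.Perm (Fin (k + 2)) :=
      fun i => (t i, Equiv.swap i.castSucc i.succ) with hT
    have hTb : IsBraidInvolutive T := ht.prodMk (.swap _)
    set D := f.prod (Equiv.Perm.consHom (k + 1)) with hD
    have hDT (j : Fin k) : D (Equiv.swap j.castSucc j.succ) = T j.succ := by
      refine Prod.ext (hf j) ?_
      simp [hD, hT, Equiv.Perm.consHom_swap]
    have normal : ∀ x ∈ Submonoid.closure (Set.range T),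
        ∃ p g, x = descendingProd T p * D g := by
      intro x hx
      induction hx using Submonoid.closure_induction_left with
      | one => exact ⟨0, 1, by simp⟩
      | mul_left a ha y hy ih =>
        obtain ⟨i, rfl⟩ := ha
        obtain ⟨p, g, rfl⟩ := ih
        rcases hTb.exists_mul_descendingProd i p with ⟨p', h⟩ | ⟨j, h⟩
        · exact ⟨p', g, by rw [← mul_assoc, h]⟩
        · exact ⟨p, Equiv.swap j.castSucc j.succ * g, by
            rw [← mul_assoc, h, map_mul, hDT, mul_assoc]⟩
    obtain ⟨F, hF⟩ := (Submonoid.closure (Set.range T)).exists_hom_of_graph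
      (fun g => by
        have hg : g ∈ (Submonoid.closure (Set.range T)).map (MonoidHom.snd _ _) := by
          rw [MonoidHom.map_mclosure, ← Set.range_comp]
          exact (Equiv.Perm.mclosure_swap_castSucc_succ (k + 1)).symm ▸ Submonoid.mem_top g
        obtain ⟨⟨q, g'⟩, h, rfl⟩ := hg
        exact ⟨q, h⟩)
      (fun x hx y hy hxy => by
        obtain ⟨p, g, rfl⟩ := normal x hx
        obtain ⟨p', g', rfl⟩ := normal y hy
        simp only [Prod.snd_mul, hT, snd_descendingProd, hD, MonoidHom.prod_apply] at hxy
        have hp : p = p' := by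
          simpa [descendingProd_swap_apply_zero] using congrArg (fun h => h 0) hxy
        subst hp
        rw [Equiv.Perm.consHom_injective _ (mul_left_cancel hxy)])
    exact ⟨F, fun i => hF (T i) (Submonoid.subset_closure ⟨i, rfl⟩)⟩

/-- Compatible actions on a monoid `Q` of the symmetric group on `{0, …, k}` and of a monoid with
zero `N`, which is placed at the point `0`. -/
structure WreathAction (N Q : Type*) [MonoidWithZero N] [Monoid Q] (k : ℕ) where
  /-- the action of the symmetric group -/
  perm : Equiv.Perm (Fin (k + 1)) →* Q
  /-- the action of the monoid at the point `0` -/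
  base : N →* Q
  perm_base (g : Equiv.Perm (Fin (k + 1))) (hg : g 0 = 0) (x : N) :
    perm g * base x = base x * perm g
  base_base (j : Fin (k + 1)) (hj : j ≠ 0) (x y : N) :
    base x * (perm (Equiv.swap 0 j) * base y * perm (Equiv.swap 0 j)) =
      perm (Equiv.swap 0 j) * base y * perm (Equiv.swap 0 j) * base x
  base_absorb (j : Fin (k + 1)) (hj : j ≠ 0) :
    base 0 * perm (Equiv.swap 0 j) * base 0 * perm (Equiv.swap 0 j) =
      base 0 * perm (Equiv.swap 0 j) * base 0

namespace WreathAction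

variable {N Q : Type*} [MonoidWithZero N] [Monoid Q] {k : ℕ} (A : WreathAction N Q k)

theorem perm_swap_mul_self (i j : Fin (k + 1)) :
    A.perm (Equiv.swap i j) * A.perm (Equiv.swap i j) = 1 := by
  rw [← map_mul, Equiv.swap_mul_self, map_one]

theorem perm_mul_left_cancel (g : Equiv.Perm (Fin (k + 1))) {x y : Q}
    (h : A.perm g * x = A.perm g * y) : x = y :=
  ((Group.isUnit g).map A.perm).mul_left_cancel h

/-- The action of `N` at the point `i`. -/
def atPoint (i : Fin (k + 1)) : N →* Q where
  toFun x := A.perm (Equiv.swap 0 i) * A.base x * A.perm (Equiv.swap 0 i)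
  map_one' := by rw [map_one, mul_one, perm_swap_mul_self]
  map_mul' x y := by
    rw [map_mul]
    simp only [mul_assoc]
    rw [← mul_assoc (A.perm (Equiv.swap 0 i)) (A.perm (Equiv.swap 0 i)), perm_swap_mul_self,
      one_mul]

theorem atPoint_apply (i : Fin (k + 1)) (x : N) :
    A.atPoint i x = A.perm (Equiv.swap 0 i) * A.base x * A.perm (Equiv.swap 0 i) := rfl

theorem atPoint_zero (x : N) : A.atPoint 0 x = A.base x := by
  rw [atPoint_apply, Equiv.swap_self]
  change A.perm 1 * _ * A.perm 1 = _
  simp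

theorem perm_mul_atPoint (g : Equiv.Perm (Fin (k + 1))) (i : Fin (k + 1)) (x : N) :
    A.perm g * A.atPoint i x = A.atPoint (g i) x * A.perm g := by
  have h := A.perm_base (Equiv.swap 0 (g i) * g * Equiv.swap 0 i) (by simp) x
  apply A.perm_mul_left_cancel (Equiv.swap 0 (g i))
  calc _ = A.perm (Equiv.swap 0 (g i) * g * Equiv.swap 0 i) * A.base x *
        A.perm (Equiv.swap 0 i) := by
        rw [atPoint_apply]; simp only [map_mul, mul_assoc]
    _ = A.base x * A.perm (Equiv.swap 0 (g i) * g) := by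
        rw [h, mul_assoc, ← map_mul, Equiv.mul_swap_mul_self]
    _ = _ := by
        rw [atPoint_apply, map_mul, ← mul_assoc, ← mul_assoc, ← mul_assoc, ← mul_assoc,
          perm_swap_mul_self, one_mul]

theorem atPoint_commute : Pairwise fun i j => ∀ x y, Commute (A.atPoint i x) (A.atPoint j y) := by
  intro i j hij x y
  apply A.perm_mul_left_cancel (Equiv.swap 0 i)
  have hj : Equiv.swap 0 i j ≠ 0 := fun h => hij (by
    simpa using congrArg (Equiv.swap 0 i) h.symm)
  rw [← mul_assoc, ← mul_assoc, perm_mul_atPoint, perm_mul_atPoint, mul_assoc, mul_assoc,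
    perm_mul_atPoint, perm_mul_atPoint, ← mul_assoc, ← mul_assoc, Equiv.swap_apply_right,
    atPoint_zero, atPoint_apply, A.base_base _ hj]

theorem atPoint_absorb {i j : Fin (k + 1)} (hij : i ≠ j) :
    A.atPoint i 0 * A.atPoint j 0 * A.perm (Equiv.swap i j) =
      A.atPoint i 0 * A.atPoint j 0 := by
  apply A.perm_mul_left_cancel (Equiv.swap 0 i)
  set l := Equiv.swap 0 i j with hl
  have hl0 : l ≠ 0 := fun h => hij (by
    simpa [hl] using congrArg (Equiv.swap 0 i) h.symm)
  have hs : Equiv.swap 0 i * Equiv.swap i j = Equiv.swap 0 l * Equiv.swap 0 i := by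
    have := Equiv.mul_swap_eq_swap_mul (Equiv.swap 0 i) i j
    rwa [Equiv.swap_apply_right] at this
  have key : A.atPoint 0 0 * A.atPoint l 0 * A.perm (Equiv.swap 0 l) =
      A.atPoint 0 0 * A.atPoint l 0 := by
    rw [atPoint_zero, atPoint_apply]
    have h := A.base_absorb l hl0
    simp only [mul_assoc] at h ⊢
    rw [perm_swap_mul_self, mul_one, h]
  calc _ = A.atPoint 0 0 * A.atPoint l 0 * A.perm (Equiv.swap 0 i * Equiv.swap i j) := by
        rw [← mul_assoc, ← mul_assoc, perm_mul_atPoint, mul_assoc _ (A.perm _), perm_mul_atPoint,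
          Equiv.swap_apply_right, map_mul]
        simp only [mul_assoc, hl]
    _ = A.atPoint 0 0 * A.atPoint l 0 * A.perm (Equiv.swap 0 i) := by
        rw [hs, map_mul, ← mul_assoc, key]
    _ = _ := by
        rw [← mul_assoc, perm_mul_atPoint, mul_assoc _ (A.perm _), perm_mul_atPoint,
          Equiv.swap_apply_right, mul_assoc]

/-- The action of the tuples over `N`. -/
def tuple : (Fin (k + 1) → N) →* Q := MonoidHom.noncommPiCoprod A.atPoint A.atPoint_commute

@[simp]
theorem tuple_mulSingle (i : Fin (k + 1)) (x : N) :
    A.tuple (Pi.mulSingle i x) = A.atPoint i x :=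
  MonoidHom.noncommPiCoprod_mulSingle ..

theorem perm_mul_tuple (g : Equiv.Perm (Fin (k + 1))) (a : Fin (k + 1) → N) :
    A.perm g * A.tuple a = A.tuple (a ∘ ⇑g⁻¹) * A.perm g := by
  let f : (Fin (k + 1) → N) →* Q :=
    { toFun := fun b => A.perm g⁻¹ * A.tuple (b ∘ ⇑g⁻¹) * A.perm g
      map_one' := by
        change A.perm g⁻¹ * A.tuple 1 * A.perm g = 1
        rw [map_one, mul_one, ← map_mul, inv_mul_cancel, map_one]
      map_mul' := fun b c => by
        change A.perm g⁻¹ * A.tuple (b ∘ ⇑g⁻¹ * c ∘ ⇑g⁻¹) * A.perm g = _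
        have h : A.perm g * A.perm g⁻¹ = 1 := by rw [← map_mul, mul_inv_cancel, map_one]
        rw [map_mul]
        simp only [mul_assoc]
        rw [← mul_assoc (A.perm g) (A.perm g⁻¹), h, one_mul] }
  have hf : f = A.tuple := by
    refine MonoidHom.pi_ext fun i x => ?_
    have hs : (Pi.mulSingle i x : Fin (k + 1) → N) ∘ ⇑g⁻¹ = Pi.mulSingle (g i) x := by
      funext j
      simp only [Function.comp_apply, Pi.mulSingle_apply, Equiv.Perm.inv_eq_iff_eq]
    change A.perm g⁻¹ * A.tuple (Pi.mulSingle i x ∘ ⇑g⁻¹) * A.perm g = _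
    rw [hs, tuple_mulSingle, tuple_mulSingle, perm_mul_atPoint,
      show g⁻¹ (g i) = i from g.symm_apply_apply i, mul_assoc, ← map_mul, inv_mul_cancel, map_one, mul_one]
  conv_lhs => rw [← hf]
  change A.perm g * (A.perm g⁻¹ * A.tuple (a ∘ ⇑g⁻¹) * A.perm g) = _
  rw [← mul_assoc, ← mul_assoc, ← map_mul, mul_inv_cancel, map_one, one_mul]

theorem tuple_mul_perm_swap {a : Fin (k + 1) → N} {i j : Fin (k + 1)} (hi : a i = 0)
    (hj : a j = 0) (hij : i ≠ j) : A.tuple a * A.perm (Equiv.swap i j) = A.tuple a := by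
  have ha : a = a * (Pi.mulSingle i 0 * Pi.mulSingle j 0) := by
    funext l
    by_cases h1 : l = i
    · subst h1; simp [hi]
    · by_cases h2 : l = j
      · subst h2; simp [hj]
      · simp [h1, h2]
  rw [ha, map_mul, map_mul, tuple_mulSingle, tuple_mulSingle, mul_assoc, atPoint_absorb _ hij]

theorem tuple_mul_perm_eq_self {a : Fin (k + 1) → N} {g : Equiv.Perm (Fin (k + 1))}
    (hg : ∀ i, a i ≠ 0 → g i = i) : A.tuple a * A.perm g = A.tuple a := by
  classical
  obtain ⟨g', rfl⟩ : ∃ g' : Equiv.Perm {i // a i = 0}, Equiv.Perm.ofSubtype g' = g := by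
    have h1 (x) : a (g x) = 0 ↔ a x = 0 := by
      constructor
      · intro h
        by_contra hx
        rw [hg x hx] at h
        exact hx h
      · intro h
        by_contra hx
        rw [g.injective (hg _ hx)] at hx
        exact hx h
    refine ⟨g.subtypePerm h1, Equiv.Perm.ofSubtype_subtypePerm h1 fun x hx => ?_⟩
    by_contra h
    exact hx (hg x h)
  clear hg
  induction g' using Equiv.Perm.swap_induction_on with
  | one => simp
  | swap_mul f x y hxy ih =>
    rw [map_mul, Equiv.Perm.ofSubtype_swap_eq, map_mul, ← mul_assoc,
      A.tuple_mul_perm_swap x.2 y.2 (fun h => hxy (Subtype.ext h)), ih]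

theorem tuple_mul_perm_inv_congr {a : Fin (k + 1) → N} {g h : Equiv.Perm (Fin (k + 1))}
    (hgh : ∀ i, a i ≠ 0 → g i = h i) : A.tuple a * A.perm g⁻¹ = A.tuple a * A.perm h⁻¹ := by
  have h1 : g⁻¹ = g⁻¹ * h * h⁻¹ := by group
  rw [h1, map_mul, ← mul_assoc, A.tuple_mul_perm_eq_self]
  intro i hi
  rw [Equiv.Perm.mul_apply, ← hgh i hi]
  exact g.symm_apply_apply i

end WreathAction

theorem PEquiv.exists_perm_extending {α : Type*} [Finite α] (f : α ≃. α) :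
    ∃ g : Equiv.Perm α, ∀ i j, f i = some j → g i = j := by
  classical
  have := Fintype.ofFinite α
  let F : α → α := fun i => (f i).getD i
  have hF : ∀ i j, f i = some j → F i = j := fun i j h => by simp [F, h]
  obtain ⟨g, hg⟩ := Set.MapsTo.exists_equiv_extend_of_card_eq (β := α)
    (t := Finset.univ) (Finset.card_univ (α := α)).symm
    (s := {i | (f i).isSome}) (f := F) (fun _ _ => Finset.mem_coe.mpr (Finset.mem_univ _))
    (fun i hi j hj hij => by
      obtain ⟨i', hi'⟩ := Option.isSome_iff_exists.mp hi
      obtain ⟨j', hj'⟩ := Option.isSome_iff_exists.mp hj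
      rw [hF _ _ hi', hF _ _ hj'] at hij
      exact f.inj hi' (hij ▸ hj'))
  refine ⟨g.trans (Equiv.subtypeUnivEquiv Finset.mem_univ), fun i j h => ?_⟩
  rw [← hF i j h]
  exact hg i (by simp [h])

namespace WreathSymInv

variable {M : Type*}

/-- A permutation that extends the second component of `p`. -/
noncomputable def permExt {n : ℕ} (p : WreathSymInv M n) : Equiv.Perm (Fin n) :=
  p.map.exists_perm_extending.choose

theorem permExt_eq {n : ℕ} (p : WreathSymInv M n) {i j : Fin n} (h : p.map i = some j) :
    p.permExt i = j :=
  p.map.exists_perm_extending.choose_spec i j h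

theorem tuple_ne_zero_iff {n : ℕ} (p : WreathSymInv M n) (i : Fin n) :
    p.tuple i ≠ 0 ↔ ∃ j, p.map i = some j := by
  rw [← Option.isSome_iff_exists]
  exact Set.ext_iff.mp p.supp_eq_dom i

end WreathSymInv

namespace WreathAction

variable {M Q : Type*} [Monoid M] [Monoid Q] {k : ℕ} (A : WreathAction (WithZero M) Q k)

theorem tuple_mul_perm_congr (p : WreathSymInv M (k + 1)) {g h : Equiv.Perm (Fin (k + 1))}
    (hg : ∀ i j, p.map i = some j → g i = j) (hh : ∀ i j, p.map i = some j → h i = j) :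
    A.tuple p.tuple * A.perm g⁻¹ = A.tuple p.tuple * A.perm h⁻¹ := by
  refine A.tuple_mul_perm_inv_congr fun i hi => ?_
  obtain ⟨j, hj⟩ := (p.tuple_ne_zero_iff i).mp hi
  rw [hg i j hj, hh i j hj]

/-- The morphism from the wreath product determined by a pair of compatible actions. -/
noncomputable def lift : WreathSymInv M (k + 1) →* Q where
  toFun p := A.tuple p.tuple * A.perm p.permExt⁻¹
  map_one' := by
    rw [A.tuple_mul_perm_congr 1 (h := 1) (fun i j => WreathSymInv.permExt_eq _)
      (fun i j h => Option.some.inj h)]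
    rw [WreathSymInv.one_tuple, map_one, inv_one, map_one, one_mul]
  map_mul' p q := by
    rw [A.tuple_mul_perm_congr (p * q) (h := q.permExt * p.permExt)
      (fun i j => WreathSymInv.permExt_eq _) (fun i j h => by
        change (p.map i).bind q.map = some j at h
        obtain ⟨l, hl, hj⟩ := Option.bind_eq_some_iff.mp h
        rw [Equiv.Perm.mul_apply, p.permExt_eq hl, q.permExt_eq hj])]
    have ht : (p * q).tuple = p.tuple * (q.tuple ∘ p.permExt) := by
      rw [WreathSymInv.mul_tuple]
      funext i
      by_cases hi : p.tuple i = 0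
      · simp [hi]
      · obtain ⟨j, hj⟩ := (p.tuple_ne_zero_iff i).mp hi
        simp [SymInv.act, hj, p.permExt_eq hj]
    have hc := A.perm_mul_tuple p.permExt⁻¹ q.tuple
    rw [inv_inv] at hc
    rw [ht, map_mul, mul_inv_rev, map_mul, mul_assoc, mul_assoc, ← mul_assoc (A.tuple _) (A.perm _),
      ← hc, mul_assoc]

theorem lift_apply (p : WreathSymInv M (k + 1)) {g : Equiv.Perm (Fin (k + 1))}
    (hg : ∀ i j, p.map i = some j → g i = j) :
    A.lift p = A.tuple p.tuple * A.perm g⁻¹ :=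
  A.tuple_mul_perm_congr p (fun _ _ => p.permExt_eq) hg

theorem lift_ofTuple (a : Fin (k + 1) → WithZero M) :
    A.lift (WreathSymInv.ofTuple a) = A.tuple a := by
  rw [A.lift_apply _ (g := 1), inv_one, map_one, mul_one]
  · rfl
  · intro i j h
    classical
    exact ((PEquiv.mem_ofSet_iff (s := Function.support a)).mp h).1.symm

theorem lift_ofSymInv_toPEquiv (g : Equiv.Perm (Fin (k + 1))) :
    A.lift (WreathSymInv.ofSymInv g.toPEquiv) = A.perm g⁻¹ := by
  rw [A.lift_apply _ (g := g) (fun i j h => Option.some.inj h)]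
  have : (WreathSymInv.ofSymInv (M := M) g.toPEquiv).tuple = 1 := by
    funext i
    simp [WreathSymInv.ofSymInv, Equiv.toPEquiv_apply]
  rw [this, map_one, one_mul]

end WreathAction

namespace WreathSymInv

variable {M : Type*} {n : ℕ}

theorem eq_of_forall {p q : WreathSymInv M n} {g h : Equiv.Perm (Fin n)}
    (hp : ∀ i j, p.map i = some j → g i = j) (hq : ∀ i j, q.map i = some j → h i = j)
    (ht : p.tuple = q.tuple) (hgh : ∀ i, p.tuple i ≠ 0 → g i = h i) : p = q := by
  refine WreathSymInv.ext ht (PEquiv.ext fun i => Option.ext fun j => ?_)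
  have hpi := p.tuple_ne_zero_iff i
  have hqi := q.tuple_ne_zero_iff i
  rw [← ht] at hqi
  constructor
  · intro hj
    have h0 := hpi.mpr ⟨j, hj⟩
    obtain ⟨l, hl⟩ := hqi.mp h0
    rw [hl, ← hq i l hl, ← hgh i h0, hp i j hj]
  · intro hj
    have h0 := hqi.mpr ⟨j, hj⟩
    obtain ⟨l, hl⟩ := hpi.mp h0
    rw [hl, ← hp i l hl, hgh i h0, hq i j hj]

theorem ofTuple_map_eq {a : Fin n → WithZero M} {i j : Fin n} (h : (ofTuple a).map i = some j) :
    i = j := by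
  classical
  exact ((PEquiv.mem_ofSet_iff (s := Function.support a)).mp h).1.symm

variable [Monoid M]

/-- A permutation, as an element of the wreath product. -/
def ofPerm (g : Equiv.Perm (Fin n)) : WreathSymInv M n := ofSymInv g.toPEquiv

theorem ofPerm_tuple (g : Equiv.Perm (Fin n)) : (ofPerm g : WreathSymInv M n).tuple = 1 := by
  funext i
  simp [ofPerm, ofSymInv, Equiv.toPEquiv_apply]

theorem ofPerm_one : (ofPerm 1 : WreathSymInv M n) = 1 :=
  WreathSymInv.ext (ofPerm_tuple 1) rfl

theorem ofPerm_mul (g h : Equiv.Perm (Fin n)) :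
    (ofPerm g * ofPerm h : WreathSymInv M n) = ofPerm (h * g) := by
  refine WreathSymInv.ext ?_ rfl
  rw [mul_tuple, ofPerm_tuple, ofPerm_tuple, ofPerm_tuple, one_mul]
  rfl

theorem ofTuple_mul_ofPerm_tuple (a : Fin n → WithZero M) (g : Equiv.Perm (Fin n)) :
    (ofTuple a * ofPerm g).tuple = a := by
  rw [mul_tuple, ofPerm_tuple]
  funext i
  by_cases hi : a i = 0
  · exact (by rw [Pi.mul_apply]; change a i * _ = _; rw [hi, zero_mul])
  · obtain ⟨j, hj⟩ := ((ofTuple a).tuple_ne_zero_iff i).mp hi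
    simp only [Pi.mul_apply, SymInv.act, hj]
    exact mul_one (a i)

theorem ofTuple_mul_ofPerm_map {a : Fin n → WithZero M} {g : Equiv.Perm (Fin n)} {i j : Fin n}
    (h : (ofTuple a * ofPerm g).map i = some j) : g i = j := by
  obtain ⟨l, hl, hj⟩ := Option.bind_eq_some_iff.mp h
  rw [ofTuple_map_eq hl]
  exact Option.some.inj hj

theorem ofTuple_mul_ofPerm_congr {a : Fin n → WithZero M} {g h : Equiv.Perm (Fin n)}
    (hgh : ∀ i, a i ≠ 0 → g i = h i) : ofTuple a * ofPerm g = ofTuple a * ofPerm h :=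
  eq_of_forall (fun _ _ => ofTuple_mul_ofPerm_map) (fun _ _ => ofTuple_mul_ofPerm_map)
    (by rw [ofTuple_mul_ofPerm_tuple, ofTuple_mul_ofPerm_tuple])
    (fun i hi => hgh i (by rwa [ofTuple_mul_ofPerm_tuple] at hi))

theorem ofTuple_mul_ofPerm_permExt (p : WreathSymInv M n) :
    ofTuple p.tuple * ofPerm p.permExt = p :=
  eq_of_forall (fun _ _ => ofTuple_mul_ofPerm_map) (fun _ _ => p.permExt_eq)
    (ofTuple_mul_ofPerm_tuple _ _) (fun _ _ => rfl)

theorem ofPerm_mul_ofTuple (g : Equiv.Perm (Fin n)) (a : Fin n → WithZero M) :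
    ofPerm g * ofTuple a = ofTuple (a ∘ g) * ofPerm g := by
  refine eq_of_forall (g := g) (fun i j h => ?_) (fun _ _ => ofTuple_mul_ofPerm_map) ?_
    (fun _ _ => rfl)
  · change (some (g i)).bind (ofTuple a).map = some j at h
    exact ofTuple_map_eq h
  · rw [ofTuple_mul_ofPerm_tuple, mul_tuple, ofPerm_tuple, one_mul]
    rfl

theorem ofTuple_one : (ofTuple 1 : WreathSymInv M n) = 1 :=
  eq_of_forall (g := 1) (h := 1) (fun _ _ => ofTuple_map_eq) (fun _ _ h => Option.some.inj h) rfl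
    (fun _ _ => rfl)

theorem ofTuple_mul (a b : Fin n → WithZero M) : ofTuple (a * b) = ofTuple a * ofTuple b := by
  refine eq_of_forall (g := 1) (h := 1) (fun _ _ => ofTuple_map_eq) (fun i j h => ?_) ?_
    (fun _ _ => rfl)
  · obtain ⟨l, hl, hj⟩ := Option.bind_eq_some_iff.mp h
    exact (ofTuple_map_eq hl).trans (ofTuple_map_eq hj)
  · rw [mul_tuple]
    funext i
    by_cases hi : a i = 0
    · change a i * b i = a i * _
      rw [hi, zero_mul, zero_mul]
    · obtain ⟨j, hj⟩ := ((ofTuple a).tuple_ne_zero_iff i).mp hi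
      simp only [Pi.mul_apply, SymInv.act, hj]
      rw [← ofTuple_map_eq hj]
      rfl

/-- `WreathSymInv.ofTuple` as a morphism. -/
noncomputable def ofTupleHom : (Fin n → WithZero M) →* WreathSymInv M n where
  toFun := ofTuple
  map_one' := ofTuple_one
  map_mul' := ofTuple_mul

/-- An element of `M ∪ {0}` placed at the point `i`. -/
noncomputable def ofSingle (i : Fin n) : WithZero M →* WreathSymInv M n :=
  ofTupleHom.comp (MonoidHom.mulSingle (fun _ => WithZero M) i)

theorem ofSingle_apply (i : Fin n) (x : WithZero M) :
    ofSingle i x = ofTuple (Pi.mulSingle i x) := rfl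

theorem ofPerm_mul_ofSingle (g : Equiv.Perm (Fin n)) (i : Fin n) (x : WithZero M) :
    ofPerm g * ofSingle (g i) x = ofSingle i x * ofPerm g := by
  rw [ofSingle_apply, ofPerm_mul_ofTuple, ofSingle_apply]
  congr 2
  funext j
  simp [Pi.mulSingle_apply]

theorem ofPerm_swap_mul_self (i j : Fin n) :
    (ofPerm (Equiv.swap i j) * ofPerm (Equiv.swap i j) : WreathSymInv M n) = 1 := by
  rw [ofPerm_mul, Equiv.swap_mul_self, ofPerm_one]

theorem ofPerm_swap_conj (i j : Fin n) (x : WithZero M) :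
    ofPerm (Equiv.swap i j) * ofSingle i x * ofPerm (Equiv.swap i j) = ofSingle j x := by
  have h := ofPerm_mul_ofSingle (Equiv.swap i j) j x
  rw [Equiv.swap_apply_right] at h
  rw [h, mul_assoc, ofPerm_swap_mul_self, mul_one]

theorem ofSingle_commute {i j : Fin n} (hij : i ≠ j) (x y : WithZero M) :
    ofSingle i x * ofSingle j y = ofSingle j y * ofSingle i x :=
  ((Pi.mulSingle_commute hij x y).map ofTupleHom).eq

theorem ofSingle_zero_mul_ofPerm_swap {i j : Fin n} (hij : i ≠ j) :
    (ofSingle i 0 * ofSingle j 0 * ofPerm (Equiv.swap i j) : WreathSymInv M n) =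
      ofSingle i 0 * ofSingle j 0 := by
  rw [ofSingle_apply, ofSingle_apply, ← ofTuple_mul,
    ofTuple_mul_ofPerm_congr (h := 1), ofPerm_one, mul_one]
  intro l hl
  have h1 : l ≠ i := by rintro rfl; simp at hl
  have h2 : l ≠ j := by rintro rfl; simp at hl
  rw [Equiv.swap_apply_of_ne_of_ne h1 h2, Equiv.Perm.one_apply]

theorem ofSymInv_e {k : ℕ} :
    (ofSymInv (PopovaGen.toSymInv .e) : WreathSymInv M (k + 1)) = ofSingle 0 0 := by
  have h1 : ∀ i j : Fin (k + 1), (PopovaGen.toSymInv .e : SymInv (k + 1)) i = some j → i = j :=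
    fun i j h => ((PEquiv.mem_ofSet_iff (s := {l : Fin (k + 1) | l.val ≠ 0})).mp h).1.symm
  refine eq_of_forall (g := 1) (h := 1) h1 (fun _ _ => ofTuple_map_eq) (funext fun i => ?_)
    (fun _ _ => rfl)
  change (if ((PopovaGen.toSymInv .e : SymInv (k + 1)) i).isSome then (1 : WithZero M) else 0) =
    (Pi.mulSingle 0 0 : Fin (k + 1) → WithZero M) i
  by_cases hi : i = 0
  · subst hi
    simp [PopovaGen.toSymInv, PEquiv.ofSet]
  · simp [PopovaGen.toSymInv, PEquiv.ofSet, hi]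

/-- A submonoid of the wreath product that contains the generators is everything. -/
theorem eq_top_of_mem {k : ℕ} {S : Submonoid (WreathSymInv M (k + 1))}
    (hs : ∀ i : Fin k, ofPerm (Equiv.swap i.castSucc i.succ) ∈ S)
    (hx : ∀ x, ofSingle 0 x ∈ S) : S = ⊤ := by
  have hg : ∀ g, ofPerm g ∈ S := fun g => by
    have hg : g ∈ Submonoid.closure
        (Set.range fun i : Fin k => Equiv.swap i.castSucc i.succ) := by
      rw [Equiv.Perm.mclosure_swap_castSucc_succ]; exact Submonoid.mem_top g
    induction hg using Submonoid.closure_induction with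
    | mem g hg => obtain ⟨i, rfl⟩ := hg; exact hs i
    | one => rw [ofPerm_one]; exact S.one_mem
    | mul g h _ _ ihg ihh => rw [← ofPerm_mul]; exact S.mul_mem ihh ihg
  have ha : ∀ a, ofTuple a ∈ S := fun a => by
    change a ∈ S.comap ofTupleHom
    rw [← Finset.noncommProd_mulSingle a]
    refine Submonoid.noncommProd_mem _ _ _ _ fun i _ => ?_
    change ofSingle i (a i) ∈ S
    rw [← ofPerm_swap_conj 0 i]
    exact S.mul_mem (S.mul_mem (hg _) (hx _)) (hg _)
  refine eq_top_iff.mpr fun p _ => ?_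
  rw [← ofTuple_mul_ofPerm_permExt p]
  exact S.mul_mem (ha _) (hg _)

end WreathSymInv

section

open WreathGen WreathSymInv

variable {M X : Type*} [Monoid M] {k : ℕ} (φ : FreeMonoid X →* M)

theorem wreathHom_s (i : Fin k) :
    wreathHom (k + 1) φ (s i) = ofPerm (Equiv.swap i.castSucc i.succ) := rfl

theorem wreathHom_e : wreathHom (k + 1) φ e = ofSingle 0 0 := ofSymInv_e

theorem wreathHom_gen (x : X) :
    wreathHom (k + 1) φ (gen x) = ofSingle 0 ((φ (FreeMonoid.of x) : M) : WithZero M) := by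
  change ofTuple _ = ofTuple _
  congr 1
  funext i
  by_cases hi : i = 0
  · subst hi; simp
  · simp [hi]

theorem wreathHom_map_inr (w : FreeMonoid X) :
    wreathHom (k + 1) φ (FreeMonoid.map Sum.inr w) = ofSingle 0 ((φ w : M) : WithZero M) := by
  induction w using FreeMonoid.inductionOn' with
  | one => simp
  | of_mul x w ih =>
    rw [map_mul, map_mul, ih, FreeMonoid.map_of, map_mul, WithZero.coe_mul, map_mul,
      ← wreathHom_gen]
    rfl

theorem wreathHom_popova {u v : FreeMonoid (PopovaGen (k + 1))} (h : PopovaRel (k + 1) u v) :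
    wreathHom (k + 1) φ (FreeMonoid.map Sum.inl u) =
      wreathHom (k + 1) φ (FreeMonoid.map Sum.inl v) := by
  have hb := IsBraidInvolutive.swap k
  have hs (i : Fin k) : wreathHom (k + 1) φ (FreeMonoid.of (Sum.inl (.s i))) =
    ofPerm (Equiv.swap i.castSucc i.succ) := rfl
  have he : wreathHom (k + 1) φ (FreeMonoid.of (Sum.inl .e)) = ofSingle 0 0 := wreathHom_e φ
  cases h with
  | s_sq i =>
    simp only [map_mul, map_one, FreeMonoid.map_of, hs, ofPerm_swap_mul_self]
  | s_comm i j h =>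
    simp only [map_mul, FreeMonoid.map_of, hs, ofPerm_mul]
    rcases lt_abs.mp h with h | h
    · rw [hb.comm j i (by omega)]
    · rw [hb.comm i j (by omega)]
  | braid i j h =>
    simp only [map_mul, FreeMonoid.map_of, hs, ofPerm_mul, ← mul_assoc]
    rcases (abs_eq zero_le_one).mp h with h | h
    · rw [hb.braid j i (by omega)]
    · rw [hb.braid i j (by omega)]
  | e_sq =>
    simp only [map_mul, FreeMonoid.map_of, he]
    rw [← map_mul, mul_zero]
  | eses_ese i h =>
    have hi : i.castSucc = (0 : Fin (k + 1)) := Fin.ext h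
    have h0 := ofPerm_swap_conj (M := M) 0 i.succ 0
    have h1 := ofSingle_zero_mul_ofPerm_swap (M := M) (Fin.succ_ne_zero i).symm
    simp only [map_mul, FreeMonoid.map_of, he, hs, hi]
    rw [← h0] at h1
    simp only [mul_assoc, ofPerm_swap_mul_self, mul_one] at h1 ⊢
    exact h1.symm
  | ese_sese i h =>
    have hi : i.castSucc = (0 : Fin (k + 1)) := Fin.ext h
    have h0 := ofPerm_swap_conj (M := M) 0 i.succ 0
    have h1 := ofSingle_zero_mul_ofPerm_swap (M := M) (Fin.succ_ne_zero i).symm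
    have h2 := ofSingle_commute (M := M) (Fin.succ_ne_zero i).symm 0 0
    simp only [map_mul, FreeMonoid.map_of, he, hs, hi]
    rw [h0, ← h2, ← h1, ← h0]
    simp only [mul_assoc, ofPerm_swap_mul_self, mul_one]
  | es_comm i h =>
    simp only [map_mul, FreeMonoid.map_of, he, hs]
    have h1 : Equiv.swap i.castSucc i.succ 0 = (0 : Fin (k + 1)) :=
      Equiv.swap_apply_of_ne_of_ne (by simp [Fin.ext_iff]; omega) (Fin.succ_ne_zero _).symm
    have h2 := ofPerm_mul_ofSingle (M := M) (Equiv.swap i.castSucc i.succ) 0 0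
    rw [h1] at h2
    exact h2.symm

theorem wreathHom_eq_of_rel {R : FreeMonoid X → FreeMonoid X → Prop}
    (hR : ∀ u v, R u v → φ u = φ v) {u v : FreeMonoid (WreathGen (k + 1) X)}
    (h : WreathRel (k + 1) R u v) : wreathHom (k + 1) φ u = wreathHom (k + 1) φ v := by
  cases h with
  | popova u v h => exact wreathHom_popova φ h
  | base u v h => rw [wreathHom_map_inr, wreathHom_map_inr, hR u v h]
  | sx_comm i h x =>
    have h1 : Equiv.swap i.castSucc i.succ 0 = (0 : Fin (k + 1)) :=
      Equiv.swap_apply_of_ne_of_ne (by simp [Fin.ext_iff]; omega) (Fin.succ_ne_zero _).symm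
    have h2 := ofPerm_mul_ofSingle (M := M) (Equiv.swap i.castSucc i.succ) 0
      (φ (FreeMonoid.of x))
    rw [h1] at h2
    rw [map_mul, map_mul, wreathHom_s, wreathHom_gen, h2]
  | xsys_comm i h x y =>
    have hi : i.castSucc = (0 : Fin (k + 1)) := Fin.ext h
    simp only [map_mul, wreathHom_s, wreathHom_gen, hi, ofPerm_swap_conj]
    rw [← ofSingle_commute (Fin.succ_ne_zero i).symm, ← ofPerm_swap_conj 0 i.succ]
    simp only [mul_assoc]
  | esxs_comm i h x =>
    have hi : i.castSucc = (0 : Fin (k + 1)) := Fin.ext h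
    simp only [map_mul, wreathHom_s, wreathHom_gen, wreathHom_e, hi, ofPerm_swap_conj]
    rw [← ofSingle_commute (Fin.succ_ne_zero i).symm, ← ofPerm_swap_conj 0 i.succ]
    simp only [mul_assoc]
  | ex_xe x =>
    simp only [map_mul, wreathHom_e, wreathHom_gen]
    rw [← map_mul, ← map_mul, zero_mul, mul_zero]
  | xe_e x =>
    simp only [map_mul, wreathHom_e, wreathHom_gen]
    rw [← map_mul, mul_zero]

theorem wreathHom_surjective (hφ : Function.Surjective φ) :
    Function.Surjective (wreathHom (k + 1) φ) := by
  rw [← MonoidHom.mrange_eq_top]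
  refine eq_top_of_mem (fun i => ⟨s i, rfl⟩) fun x => ?_
  induction x using WithZero.recZeroCoe with
  | zero => exact ⟨e, wreathHom_e φ⟩
  | coe m =>
    obtain ⟨w, rfl⟩ := hφ m
    exact ⟨_, wreathHom_map_inr φ w⟩

end

/-- A morphism factors through a surjective morphism with a smaller kernel. -/
theorem MonoidHom.exists_factor {F M Q : Type*} [Monoid F] [Monoid M] [Monoid Q] {f : F →* M}
    (hf : Function.Surjective f) {g : F →* Q} (h : ∀ u v, f u = f v → g u = g v) :
    ∃ l : M →* Q, ∀ w, l (f w) = g w := by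
  obtain ⟨l, hl⟩ := (MonoidHom.mrange (g.prod f)).exists_hom_of_graph
    (fun m => by obtain ⟨w, rfl⟩ := hf m; exact ⟨g w, w, rfl⟩)
    (by
      rintro _ ⟨u, rfl⟩ _ ⟨v, rfl⟩ huv
      exact Prod.ext (h u v huv) huv)
  exact ⟨l, fun w => hl _ ⟨w, rfl⟩⟩

/-- The extension of a morphism `f` to `M ∪ {0}` that maps `0` to an element absorbed by the range
of `f`. -/
def MonoidHom.withZeroExtend {M Q : Type*} [Monoid M] [Monoid Q] (f : M →* Q) (z : Q)
    (hz : z * z = z) (hl : ∀ m, f m * z = z) (hr : ∀ m, z * f m = z) : WithZero M →* Q where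
  toFun x := x.recZeroCoe z f
  map_one' := by
    rw [← WithZero.coe_one]
    exact f.map_one
  map_mul' x y := by
    induction x using WithZero.recZeroCoe with
    | zero =>
      rw [zero_mul]
      induction y using WithZero.recZeroCoe with
      | zero => exact hz.symm
      | coe m => exact (hr m).symm
    | coe m =>
      induction y using WithZero.recZeroCoe with
      | zero => rw [mul_zero]; exact (hl m).symm
      | coe m' => exact f.map_mul m m'

section

variable {N Q : Type*} [MonoidWithZero N] [Monoid Q] {k : ℕ}

theorem commute_conj_iff {s a b : Q} (hs : s * s = 1) :
    Commute a (s * b * s) ↔ Commute (s * a * s) b := by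
  have h (x : Q) : s * (s * x) = x := by rw [← mul_assoc, hs, one_mul]
  constructor
  · intro hc
    have := congrArg (fun q => s * q * s) hc.eq
    simpa [mul_assoc, h, hs, Commute, SemiconjBy] using this
  · intro hc
    have := congrArg (fun q => s * q * s) hc.eq
    simpa [mul_assoc, h, hs, Commute, SemiconjBy] using this

theorem conj_mul_conj {g g' s b : Q} (h : g' * g = 1) (hb : Commute g' b) :
    g * s * g' * b * (g * s * g') = g * (s * b * s) * g' := by
  simp only [mul_assoc]
  rw [← mul_assoc g' b, hb.eq, mul_assoc b, ← mul_assoc g' g, h, one_mul]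

/-- Two actions are compatible if the base commutes with the generators of the stabiliser of `0`
and satisfies the linking relations at the points `0` and `1`. -/
theorem exists_wreathAction (σ : Equiv.Perm (Fin (k + 1)) →* Q) (τ : N →* Q)
    (hs : ∀ i : Fin k, 1 ≤ i.val → ∀ x, Commute (σ (Equiv.swap i.castSucc i.succ)) (τ x))
    (hc : ∀ i : Fin k, i.val = 0 → ∀ x y, Commute (τ x)
      (σ (Equiv.swap i.castSucc i.succ) * τ y * σ (Equiv.swap i.castSucc i.succ)))
    (ha : ∀ i : Fin k, i.val = 0 →
      τ 0 * σ (Equiv.swap i.castSucc i.succ) * τ 0 * σ (Equiv.swap i.castSucc i.succ) =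
        τ 0 * σ (Equiv.swap i.castSucc i.succ) * τ 0) :
    ∃ A : WreathAction N Q k, A.perm = σ ∧ A.base = τ := by
  have hstab (g : Equiv.Perm (Fin (k + 1))) (hg : g 0 = 0) (x : N) : Commute (σ g) (τ x) := by
    obtain ⟨g, rfl⟩ := Equiv.Perm.exists_consHom_eq g hg
    cases k with
    | zero => rw [Subsingleton.elim g 1, map_one, map_one]; exact Commute.one_left _
    | succ k =>
      have hg : g ∈ Submonoid.closure
          (Set.range fun i : Fin k => Equiv.swap i.castSucc i.succ) := by
        rw [Equiv.Perm.mclosure_swap_castSucc_succ]; exact Submonoid.mem_top g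
      clear * - hg hs
      induction hg using Submonoid.closure_induction with
      | mem g hg =>
        obtain ⟨i, rfl⟩ := hg
        rw [Equiv.Perm.consHom_swap]
        exact hs i.succ (by simp) x
      | one => rw [map_one, map_one]; exact Commute.one_left _
      | mul g h _ _ ihg ihh =>
        rw [map_mul, map_mul]
        exact ihg.mul_left ihh
  have hconj (j : Fin (k + 1)) (hj : j ≠ 0) : ∃ (i : Fin k) (G : Equiv.Perm (Fin (k + 1))),
      i.val = 0 ∧ (∀ x, Commute (σ G) (τ x)) ∧ (∀ x, Commute (σ G⁻¹) (τ x)) ∧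
      Equiv.swap 0 j = G * Equiv.swap i.castSucc i.succ * G⁻¹ := by
    obtain ⟨l, rfl⟩ := Fin.exists_succ_eq.mpr hj
    have hk : 0 < k := l.pos
    let i : Fin k := ⟨0, hk⟩
    have h0 : i.castSucc = 0 := rfl
    have hG : Equiv.swap i.succ l.succ 0 = 0 := Equiv.swap_apply_of_ne_of_ne
      (Fin.succ_ne_zero _).symm (Fin.succ_ne_zero _).symm
    refine ⟨i, Equiv.swap i.succ l.succ, rfl, hstab _ hG, fun x => ?_, ?_⟩
    · rw [Equiv.swap_inv]; exact hstab _ hG x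
    · rw [← Equiv.swap_apply_apply, h0, hG, Equiv.swap_apply_left]
  refine ⟨⟨σ, τ, fun g hg x => hstab g hg x, fun j hj x y => ?_, fun j hj => ?_⟩, rfl, rfl⟩
  · obtain ⟨i, G, hi, h1, h2, hG⟩ := hconj j hj
    have h3 : σ G⁻¹ * σ G = 1 := by rw [← map_mul, inv_mul_cancel, map_one]
    rw [hG, map_mul, map_mul, conj_mul_conj h3 (h2 y)]
    exact (((h1 x).symm.mul_right (hc i hi x y)).mul_right (h2 x).symm).eq
  · obtain ⟨i, G, hi, h1, h2, hG⟩ := hconj j hj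
    have h3 : σ G⁻¹ * σ G = 1 := by rw [← map_mul, inv_mul_cancel, map_one]
    rw [hG, map_mul, map_mul, mul_assoc (τ 0), mul_assoc (τ 0), conj_mul_conj h3 (h2 0)]
    have h4 := ha i hi
    simp only [mul_assoc] at h4 ⊢
    rw [(h2 0).eq, ← mul_assoc (τ 0) (σ G), ← mul_assoc (τ 0) (σ G), ← (h1 0).eq, mul_assoc,
      mul_assoc]
    congr 1
    simpa [mul_assoc] using congrArg (· * σ G⁻¹) h4

end

section

open WreathGen

variable {M X : Type*} [Monoid M] {k : ℕ}

theorem WreathRel.isBraidInvolutive {R : FreeMonoid X → FreeMonoid X → Prop} {Q : Type*} [Monoid Q]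
    {f : FreeMonoid (WreathGen (k + 1) X) →* Q} (hf : ∀ u v, WreathRel (k + 1) R u v → f u = f v) :
    IsBraidInvolutive fun i : Fin k => f (s i) where
  sq i := by simpa [s] using hf _ _ (.popova _ _ (PopovaRel.s_sq (n := k + 1) i))
  comm i j h := by
    simpa [s] using hf _ _ (WreathRel.popova _ _ (PopovaRel.s_comm (n := k + 1) i j (by rw [lt_abs]; right; omega)))
  braid i j h := by
    simpa [s] using hf _ _ (WreathRel.popova _ _ (PopovaRel.braid (n := k + 1) i j (by
      rw [abs_eq zero_le_one]; right; omega)))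

/-- A morphism that respects the relations of the wreath product identifies words with the same
image in the wreath product. -/
theorem WreathRel.eq_of_wreathHom_eq {R : FreeMonoid X → FreeMonoid X → Prop}
    {φ : FreeMonoid X →* M} (hφ : HasPresentationVia R φ) {Q : Type*} [Monoid Q]
    {f : FreeMonoid (WreathGen (k + 1) X) →* Q} (hf : ∀ u v, WreathRel (k + 1) R u v → f u = f v)
    {u v : FreeMonoid (WreathGen (k + 1) X)}
    (huv : wreathHom (k + 1) φ u = wreathHom (k + 1) φ v) : f u = f v := by
  have hb := WreathRel.isBraidInvolutive hf
  obtain ⟨σ, hσ⟩ := hb.exists_perm_hom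
  have hR : conGen R ≤ Con.ker (f.comp (FreeMonoid.map Sum.inr)) :=
    Con.conGen_le.mpr fun u v h => hf _ _ (.base u v h)
  obtain ⟨l, hl⟩ := MonoidHom.exists_factor hφ.1 (g := f.comp (FreeMonoid.map Sum.inr))
    fun u v h => hR (hφ.2 ▸ (h : Con.ker φ u v))
  have hlx (x : X) : l (φ (FreeMonoid.of x)) = f (gen x) := by rw [hl]; rfl
  have lind (P : Q → Prop) (h1 : P 1) (hx : ∀ x q, P q → P (f (gen x) * q)) (m : M) : P (l m) := by
    obtain ⟨w, rfl⟩ := hφ.1 m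
    induction w using FreeMonoid.inductionOn' with
    | one => rwa [map_one, map_one]
    | of_mul x w ih => rw [map_mul, map_mul, hlx]; exact hx x _ ih
  have hee : f e * f e = f e := by simpa [e] using hf _ _ (.popova _ _ .e_sq)
  have hxe (x : X) : f (gen x) * f e = f e := by simpa using hf _ _ (.xe_e x)
  have hex (x : X) : f e * f (gen x) = f e := by
    rw [← map_mul, hf _ _ (.ex_xe x), map_mul, hxe]
  let τ : WithZero M →* Q := l.withZeroExtend (f e) hee
    (lind (fun q => q * f e = f e) (one_mul _) fun x q h => by rw [mul_assoc, h, hxe])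
    (lind (fun q => f e * q = f e) (mul_one _) fun x q h => by rw [← mul_assoc, hex, h])
  have τ_zero : τ 0 = f e := rfl
  have τ_coe (m : M) : τ m = l m := rfl
  have τ_comm {c : Q} (h0 : Commute c (f e)) (hx : ∀ x, Commute c (f (gen x)))
      (a : WithZero M) : Commute c (τ a) := by
    induction a using WithZero.recZeroCoe with
    | zero => exact h0
    | coe m => exact lind (Commute c) (Commute.one_right c) (fun x q h => (hx x).mul_right h) m
  obtain ⟨A, hAσ, hAτ⟩ := exists_wreathAction σ τ
    (fun i hi x => by
      rw [hσ]
      refine τ_comm ?_ (fun x => ?_) x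
      · have := hf _ _ (WreathRel.popova _ _ (PopovaRel.es_comm (n := k + 1) i hi))
        exact Eq.symm (by simpa [s, e] using this)
      · simpa [Commute, SemiconjBy] using hf _ _ (WreathRel.sx_comm (n := k + 1) i hi x))
    (fun i hi x y => by
      rw [hσ]
      have hs := hb.sq i
      have hese : f e * f (s i) * f e * f (s i) = f (s i) * f e * f (s i) * f e := by
        have h1 := hf _ _ (WreathRel.popova _ _ (PopovaRel.eses_ese (n := k + 1) i hi))
        have h2 := hf _ _ (WreathRel.popova _ _ (PopovaRel.ese_sese (n := k + 1) i hi))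
        simpa [s, e] using h1.trans h2
      have hesx (x : X) : f e * f (s i) * f (gen x) * f (s i) =
          f (s i) * f (gen x) * f (s i) * f e := by
        simpa using hf _ _ (WreathRel.esxs_comm (n := k + 1) i hi x)
      have hxsy (x y : X) : f (gen x) * f (s i) * f (gen y) * f (s i) =
          f (s i) * f (gen y) * f (s i) * f (gen x) := by
        simpa using hf _ _ (WreathRel.xsys_comm (n := k + 1) i hi x y)
      have h1 : Commute (f (s i) * f e * f (s i)) (τ x) := by
        refine τ_comm ?_ (fun x => ?_) x
        · simpa [Commute, SemiconjBy, mul_assoc] using hese.symm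
        · rw [← commute_conj_iff hs]
          simpa [Commute, SemiconjBy, mul_assoc] using hesx x
      have h2 (y : X) : Commute (f (s i) * f (gen y) * f (s i)) (τ x) := by
        refine τ_comm ?_ (fun x => ?_) x
        · simpa [Commute, SemiconjBy, mul_assoc] using (hesx y).symm
        · simpa [Commute, SemiconjBy, mul_assoc] using (hxsy x y).symm
      rw [commute_conj_iff hs]
      exact τ_comm ((commute_conj_iff hs).mp h1.symm)
        (fun y => (commute_conj_iff hs).mp (h2 y).symm) y)
    (fun i hi => by
      rw [hσ, τ_zero]
      have := hf _ _ (WreathRel.popova _ _ (PopovaRel.eses_ese (n := k + 1) i hi))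
      simpa [s, e] using this)
  have hA : A.lift.comp (wreathHom (k + 1) φ) = f := by
    refine FreeMonoid.hom_eq fun g => ?_
    rw [MonoidHom.comp_apply]
    rcases g with (i | _) | x
    · change A.lift (WreathSymInv.ofSymInv (Equiv.toPEquiv _)) = f (s i)
      rw [A.lift_ofSymInv_toPEquiv, Equiv.swap_inv, hAσ]
      exact hσ i
    · change A.lift (wreathHom (k + 1) φ e) = f e
      rw [wreathHom_e, WreathSymInv.ofSingle_apply, A.lift_ofTuple, A.tuple_mulSingle,
        A.atPoint_zero, hAτ, τ_zero]
    · change A.lift (wreathHom (k + 1) φ (gen x)) = f (gen x)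
      rw [wreathHom_gen, WreathSymInv.ofSingle_apply, A.lift_ofTuple, A.tuple_mulSingle,
        A.atPoint_zero, hAτ, τ_coe, hlx]
  rw [← hA, MonoidHom.comp_apply, MonoidHom.comp_apply, huv]

end

theorem mainTheorem2 {M X : Type*} [Monoid M] (R : FreeMonoid X → FreeMonoid X → Prop)
    (φ : FreeMonoid X →* M) (hφ : HasPresentationVia R φ) (n : ℕ) (hn : 1 ≤ n) :
    HasPresentationVia (WreathRel n R) (wreathHom n φ) := by
  obtain ⟨k, rfl⟩ := Nat.exists_eq_add_of_le' hn
  refine ⟨wreathHom_surjective φ hφ.1, le_antisymm ?_ ?_⟩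
  · intro u v huv
    exact Quotient.exact (WreathRel.eq_of_wreathHom_eq (f := (conGen (WreathRel (k + 1) R)).mk') hφ
      (fun u v h => (Con.eq _).mpr (ConGen.Rel.of u v h)) huv)
  · refine Con.conGen_le.mpr fun u v h => wreathHom_eq_of_rel φ (fun u v h => ?_) h
    have : Con.ker φ u v := hφ.2 ▸ ConGen.Rel.of u v h
    exact this
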